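/- Let $n\ge 1$ and $k\ge 0$ be integers with $\gcd(n,k)=1$. Put $\mathcal O=\mathbb C[[t]]$, $\mathcal K=\mathbb C((t))$, let $\mathrm{Gr}=GL_n(\mathcal K)/GL_n(\mathcal O)$ be the affine Grassmannian (with its Zariski topology as an ind-variety), and let $N=\mathrm{Ad}\oplus V$ be the sum of the adjoint and the standard representation of $GL_n$. Let $v=(\gamma,e_1)\in N(\mathcal K)$, where $\gamma$ is the companion matrix of $f=x^n-t^k$, that is, $\gamma e_i=e_{i+1}$ for $1\le i<n$ and $\gamma e_n=t^k e_1$, and let $$M_v=\{[g]\in \mathrm{Gr}\;:\; g^{-1}\gamma g\in \mathfrak{gl}_n(\mathcal O),\ g^{-1}e_1\in\mathcal O^n\}$$ be the generalized affine Springer fiber of $v$. The group $(GL_n(\mathcal K)\times\mathcal O^\times)\rtimes\mathbb C^\times$, in which $\lambda\in\mathbb C^\times$ acts on the first factor by $t\mapsto \lambda t$, acts on $N(\mathcal K)$ by $(g,\mu,\lambda)\cdot(X,w)=(\mu\, g X(\lambda t) g^{-1},\, g\,w(\lambda t))$ and on $\mathrm{Gr}$ by $(g,\mu,\lambda)\cdot[h(t)]=[g\,h(\lambda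 t)]$. Let $L_v$ be the stabilizer of $v$ in this group; it acts on $M_v$. Then the fixed points of $L_v$ on $M_v$ are isolated, i.e. the fixed-point set $M_v^{L_v}$ is discrete in the Zariski topology. Moreover, $A\mapsto[t^{-A}]$, where $t^{-A}=\mathrm{diag}(t^{-A_1},\dots,t^{-A_n})$, is a bijection from the set of cocharacters $A=(A_1,\dots,A_n)\in\mathbb Z^n$ of the diagonal torus $T\subset GL_n$ such that $$\langle A,\omega_1\rangle\ge 0,\qquad \langle A,\alpha_i\rangle\le 0\ \ (1\le i\le n-1),\qquad \sum_{i=1}^{n-1}\langle A,\alpha_i\rangle\ge -k$$ onto $M_v^{L_v}$. Here $\omega_1$ is the first fundamental weight and $\alpha_1,\dots,\alpha_{n-1}$ are the simple roots of $GL_n$, so that $\langle A,\omega_1\rangle=A_1$ and $\langle A,\alpha_i\rangle=A_i-A_{i+1}$. -/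

import Mathlib

open scoped Matrix MatrixGroups

noncomputable section

namespace AffSpringer

/-! ### The field `K = ℂ((t))`, the ring `O = ℂ[[t]]` and loop rotation -/

/-- `O = ℂ[[t]]`. -/
abbrev O : Type := PowerSeries ℂ

/-- `K = ℂ((t))`. -/
abbrev K : Type := LaurentSeries ℂ

/-- The inclusion `O → K`. -/
abbrev toK : O →+* K := algebraMap O K

/-- The uniformizer `t`, as an element of `Kˣ`. -/
def t : Kˣ := Units.mk0 (HahnSeries.single (1 : ℤ) (1 : ℂ)) (by simp)

/-- The Laurent series `f(λ t)`. -/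
def rotFun (l : ℂˣ) (f : K) : K where
  coeff m := ((l ^ m : ℂˣ) : ℂ) * f.coeff m
  isPWO_support' := f.isPWO_support.mono fun m hm => by
    simp only [Function.mem_support] at hm
    exact right_ne_zero_of_mul hm

theorem rotFun_coeff (l : ℂˣ) (f : K) (m : ℤ) :
    (rotFun l f).coeff m = ((l ^ m : ℂˣ) : ℂ) * f.coeff m := rfl

theorem rotFun_support (l : ℂˣ) (f : K) : (rotFun l f).support ⊆ f.support :=
  fun m hm => right_ne_zero_of_mul (show ((l ^ m : ℂˣ) : ℂ) * f.coeff m ≠ 0 from hm)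

theorem rotFun_add (l : ℂˣ) (f g : K) : rotFun l (f + g) = rotFun l f + rotFun l g := by
  ext m
  simp [rotFun_coeff, mul_add]

theorem rotFun_mul (l : ℂˣ) (f g : K) : rotFun l (f * g) = rotFun l f * rotFun l g := by
  ext m
  rw [rotFun_coeff, HahnSeries.coeff_mul,
    HahnSeries.coeff_mul_left' f.isPWO_support (rotFun_support l f), Finset.mul_sum]
  symm
  apply Finset.sum_subset_zero_on_sdiff
  · intro p hp
    simp only [Finset.mem_antidiagonal] at hp ⊢
    exact ⟨hp.1, rotFun_support l g hp.2.1, hp.2.2⟩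
  · intro p hp
    simp only [Finset.mem_sdiff, Finset.mem_antidiagonal] at hp
    have h0 : (rotFun l g).coeff p.2 = 0 := by
      by_contra h
      exact hp.2 ⟨hp.1.1, h, hp.1.2.2⟩
    rw [rotFun_coeff] at h0
    have : g.coeff p.2 = 0 := (mul_eq_zero.mp h0).resolve_left (Units.ne_zero _)
    simp [this]
  · intro p hp
    simp only [Finset.mem_antidiagonal] at hp
    rw [rotFun_coeff, rotFun_coeff, ← hp.2.2, zpow_add]
    push_cast
    ring

theorem rotFun_comp (l l' : ℂˣ) (f : K) : rotFun l (rotFun l' f) = rotFun (l * l') f := by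
  ext m
  simp [rotFun_coeff, mul_zpow, mul_assoc]

theorem rotFun_one (f : K) : rotFun 1 f = f := by
  ext m
  simp [rotFun_coeff]

/-- Loop rotation `f(t) ↦ f(λ t)` as a field automorphism of `K`. -/
def rot (l : ℂˣ) : K ≃+* K where
  toFun := rotFun l
  invFun := rotFun l⁻¹
  left_inv f := by rw [rotFun_comp, inv_mul_cancel, rotFun_one]
  right_inv f := by rw [rotFun_comp, mul_inv_cancel, rotFun_one]
  map_mul' := rotFun_mul l
  map_add' := rotFun_add l

/-- Loop rotation `f(t) ↦ f(λ t)` as a ring automorphism of `O`. -/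
def rotO (l : ℂˣ) : O ≃+* O where
  toFun := PowerSeries.rescale (l : ℂ)
  invFun := PowerSeries.rescale ((l⁻¹ : ℂˣ) : ℂ)
  left_inv f := by rw [PowerSeries.rescale_rescale]; simp
  right_inv f := by rw [PowerSeries.rescale_rescale]; simp
  map_mul' := map_mul _
  map_add' := map_add _

theorem rot_toK (l : ℂˣ) (f : O) : rot l (toK f) = toK (rotO l f) := by
  ext m
  change ((l ^ m : ℂˣ) : ℂ) * HahnSeries.coeff (HahnSeries.ofPowerSeries ℤ ℂ f) m =
    HahnSeries.coeff (HahnSeries.ofPowerSeries ℤ ℂ (PowerSeries.rescale (l : ℂ) f)) m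
  rw [PowerSeries.coeff_coe, PowerSeries.coeff_coe]
  split_ifs with h
  · simp
  · obtain ⟨k, rfl⟩ := Int.eq_ofNat_of_zero_le (not_lt.mp h)
    simp

variable (n : ℕ)

/-! ### The groups `GL_n(K)`, `GL_n(O)` and `(GL_n × ℂˣ_dil)_K^O ⋊ ℂˣ_rot` -/

/-- `GL_n(K)`. -/
abbrev GLK : Type := GL (Fin n) K

/-- `GL_n(O)`, as a subgroup of `GL_n(K)`. -/
def GLO : Subgroup (GLK n) := (Matrix.GeneralLinearGroup.map (n := Fin n) toK).range

/-- The preimage in `GL_n(K) × Kˣ` (the `K`-points of `GL_n × ℂˣ_dil`) of the group `Oˣ` of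
`O`-points of the flavour group `ℂˣ_dil`. -/
abbrev GtildeKO : Type := GLK n × Oˣ

/-- Loop rotation on `GL_n(K)`: `g(t) ↦ g(λ t)`. -/
def rotGL (l : ℂˣ) : GLK n ≃* GLK n := Units.mapEquiv ((rot l).mapMatrix (m := Fin n)).toMulEquiv

/-- The action of `ℂˣ_rot` on `(GL_n × ℂˣ_dil)_K^O` by rescaling the variable `t`. -/
def rotAut : ℂˣ →* MulAut (GtildeKO n) where
  toFun l := (rotGL n l).prodCongr (Units.mapEquiv (rotO l).toMulEquiv)
  map_one' := by
    refine MulEquiv.ext fun x => Prod.ext (Units.ext (Matrix.ext fun i j => ?_)) (Units.ext ?_)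
    · exact rotFun_one _
    · change PowerSeries.rescale ((1 : ℂˣ) : ℂ) (x.2 : O) = x.2
      simp
  map_mul' l l' := by
    refine MulEquiv.ext fun x => Prod.ext (Units.ext (Matrix.ext fun i j => ?_)) (Units.ext ?_)
    · exact (rotFun_comp l l' _).symm
    · change PowerSeries.rescale ((l * l' : ℂˣ) : ℂ) (x.2 : O) =
        PowerSeries.rescale (l : ℂ) (PowerSeries.rescale (l' : ℂ) (x.2 : O))
      rw [PowerSeries.rescale_rescale]
      simp [mul_comm]

/-- The group `(GL_n × ℂˣ_dil)_K^O ⋊ ℂˣ_rot`. -/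
abbrev Ghat : Type := GtildeKO n ⋊[rotAut n] ℂˣ

/-! ### The representation `N = Ad ⊕ V` -/

/-- `N(K) = gl_n(K) ⊕ K^n`. -/
abbrev NK : Type := Matrix (Fin n) (Fin n) K × (Fin n → K)

variable {n}

/-- Membership in the `O`-lattice `N(O) = gl_n(O) ⊕ O^n` of `N(K)`. -/
def IsIntegral (s : NK n) : Prop :=
  (∀ i j, s.1 i j ∈ toK.range) ∧ ∀ i, s.2 i ∈ toK.range

/-- The action of `GL_n(K)` on `N(K)`: conjugation on `Ad`, matrix times vector on `V`. -/
def adV (g : GLK n) (s : NK n) : NK n :=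
  ((g : Matrix (Fin n) (Fin n) K) * s.1 * ((g⁻¹ : GLK n) : Matrix (Fin n) (Fin n) K),
    (g : Matrix (Fin n) (Fin n) K) *ᵥ s.2)

/-- `ℂˣ_dil` (with values in `O`) dilates the `Ad`-part of `N(K)`. -/
def dil (u : Oˣ) (s : NK n) : NK n := (s.1.map fun f => toK (u : O) * f, s.2)

/-- Loop rotation on `N(K)`: `s(t) ↦ s(λ t)`. -/
def rotN (l : ℂˣ) (s : NK n) : NK n := (s.1.map (rot l), fun i => rot l (s.2 i))

theorem adV_mul (g h : GLK n) (s : NK n) : adV (g * h) s = adV g (adV h s) := by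
  simp [adV, mul_assoc]

theorem adV_one (s : NK n) : adV 1 s = s := by simp [adV]

theorem dil_adV (u : Oˣ) (g : GLK n) (s : NK n) : dil u (adV g s) = adV g (dil u s) := by
  refine Prod.ext (Matrix.ext fun i j => ?_) rfl
  simp only [adV, dil, Matrix.map_apply, Matrix.mul_apply, Finset.mul_sum, Finset.sum_mul]
  exact Finset.sum_congr rfl fun a _ => Finset.sum_congr rfl fun b _ => by ring

theorem dil_mul (u w : Oˣ) (s : NK n) : dil (u * w) s = dil u (dil w s) := by
  refine Prod.ext (Matrix.ext fun i j => ?_) rfl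
  change toK ((u * w : Oˣ) : O) * s.1 i j = toK (u : O) * (toK (w : O) * s.1 i j)
  rw [Units.val_mul, map_mul, mul_assoc]

theorem rotN_adV (l : ℂˣ) (g : GLK n) (s : NK n) :
    rotN l (adV g s) = adV (rotGL n l g) (rotN l s) := by
  refine Prod.ext ?_ ?_
  · change (rot l).toRingHom.mapMatrix (m := Fin n) _ = (rot l).toRingHom.mapMatrix (m := Fin n) _ *
      (rot l).toRingHom.mapMatrix (m := Fin n) _ * (rot l).toRingHom.mapMatrix (m := Fin n) _
    rw [← map_mul, ← map_mul]
    rfl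
  · funext i
    change rot l (∑ j : Fin n, _) = ∑ j : Fin n, _
    rw [map_sum]
    exact Finset.sum_congr rfl fun j _ => map_mul _ _ _

theorem rotN_dil (l : ℂˣ) (u : Oˣ) (s : NK n) :
    rotN l (dil u s) = dil (Units.mapEquiv (rotO l).toMulEquiv u) (rotN l s) := by
  refine Prod.ext (Matrix.ext fun i j => ?_) rfl
  change rot l (toK (u : O) * s.1 i j) = toK (rotO l (u : O)) * rot l (s.1 i j)
  rw [map_mul, rot_toK]

theorem rotN_mul (l l' : ℂˣ) (s : NK n) : rotN (l * l') s = rotN l (rotN l' s) :=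
  Prod.ext (Matrix.ext fun _ _ => (rotFun_comp l l' _).symm)
    (funext fun _ => (rotFun_comp l l' _).symm)

/-- The action of `(GL_n × ℂˣ_dil)_K^O ⋊ ℂˣ_rot` on `N(K)`:
`(g, μ, λ) · (X, w) = (μ g X(λ t) g⁻¹, g w(λ t))`. -/
instance : MulAction (Ghat n) (NK n) where
  smul x s := adV x.left.1 (dil x.left.2 (rotN x.right s))
  one_smul s := by
    change adV 1 (dil 1 (rotN 1 s)) = s
    rw [adV_one]
    refine Prod.ext (Matrix.ext fun i j => ?_) (funext fun i => rotFun_one _)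
    change toK 1 * rotFun 1 (s.1 i j) = _
    rw [rotFun_one, map_one, one_mul]
  mul_smul x y s := by
    change adV (x.left.1 * rotGL n x.right y.left.1)
        (dil (x.left.2 * Units.mapEquiv (rotO x.right).toMulEquiv y.left.2)
          (rotN (x.right * y.right) s)) =
      adV x.left.1 (dil x.left.2 (rotN x.right (adV y.left.1 (dil y.left.2 (rotN y.right s)))))
    rw [rotN_adV, rotN_dil, dil_adV, adV_mul, dil_mul, rotN_mul]

theorem smul_def (x : Ghat n) (s : NK n) :
    x • s = adV x.left.1 (dil x.left.2 (rotN x.right s)) := rfl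

/-! ### The affine Grassmannian -/

variable (n)

/-- The points `GL_n(K) / GL_n(O)` of the affine Grassmannian. -/
def Gr : Type := GLK n ⧸ GLO n

variable {n}

/-- The class `[g]` of `g ∈ GL_n(K)`. -/
def Gr.mk (g : GLK n) : Gr n := QuotientGroup.mk g

theorem rotGL_mem_GLO (l : ℂˣ) {g : GLK n} (hg : g ∈ GLO n) : rotGL n l g ∈ GLO n := by
  obtain ⟨a, rfl⟩ := hg
  refine ⟨Matrix.GeneralLinearGroup.map (rotO l).toRingHom a, ?_⟩
  refine Units.ext (Matrix.ext fun i j => ?_)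
  exact (rot_toK l _).symm

/-- The action of `(GL_n × ℂˣ_dil)_K^O ⋊ ℂˣ_rot` on the affine Grassmannian:
`(g, μ, λ) · [h(t)] = [g h(λ t)]`. -/
instance : MulAction (Ghat n) (Gr n) where
  smul x := Quotient.map' (fun h => x.left.1 * rotGL n x.right h) fun a b hab => by
    rw [QuotientGroup.leftRel_apply] at hab ⊢
    have := rotGL_mem_GLO x.right hab
    rw [map_mul, map_inv] at this
    simpa [mul_assoc] using this
  one_smul p := by
    induction p using Quotient.inductionOn' with
    | h g =>
      refine congrArg Gr.mk (?_ : (1 : GLK n) * rotGL n 1 g = g)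
      rw [one_mul]
      exact Units.ext (Matrix.ext fun i j => rotFun_one _)
  mul_smul x y p := by
    induction p using Quotient.inductionOn' with
    | h g =>
      refine congrArg Gr.mk (?_ : x.left.1 * rotGL n x.right y.left.1 *
        rotGL n (x.right * y.right) g =
        x.left.1 * rotGL n x.right (y.left.1 * rotGL n y.right g))
      rw [map_mul, mul_assoc]
      congr 2
      exact Units.ext (Matrix.ext fun i j => (rotFun_comp _ _ _).symm)

theorem smul_mk (x : Ghat n) (h : GLK n) :
    x • Gr.mk h = Gr.mk (x.left.1 * rotGL n x.right h) := rfl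

/-! ### The Zariski topology on the affine Grassmannian -/

variable (n)

/-- The closed subset of those `g ∈ GL_n(K)` such that `g` and `g⁻¹` have poles of order at
most `N`. -/
def bounded (N : ℕ) : Set (GLK n) :=
  {g | ∀ i j, ∀ m : ℤ, m < -(N : ℤ) → (g i j : K).coeff m = 0 ∧ (g⁻¹ i j : K).coeff m = 0}

variable {n}

/-- The coordinates of `g ∈ GL_n(K)`: the coefficients of the entries of `g` (`false`) and of
`g⁻¹` (`true`). -/
def coord (g : GLK n) : Bool × Fin n × Fin n × ℤ → ℂ
  | (false, i, j, m) => (g i j : K).coeff m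
  | (true, i, j, m) => (g⁻¹ i j : K).coeff m

variable (n)

/-- The Zariski topology on the affine scheme of all `g ∈ GL_n(K)` such that `g` and `g⁻¹` have
poles of order at most `N`: its basic open sets are the non-vanishing loci of polynomials in the
coordinates. -/
@[reducible]
def zariskiBounded (N : ℕ) : TopologicalSpace (bounded n N) :=
  TopologicalSpace.generateFrom
    {U | ∃ P : MvPolynomial (Bool × Fin n × Fin n × ℤ) ℂ,
      U = {g : bounded n N | MvPolynomial.eval (coord (g : GLK n)) P ≠ 0}}

/-- The Zariski topology on the ind-scheme `GL_n(K)`: a set is open (closed) if its intersection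
with each of the closed pieces `bounded n N` is. -/
@[reducible]
def zariskiLoop : TopologicalSpace (GLK n) :=
  ⨆ N : ℕ, TopologicalSpace.coinduced (Subtype.val : bounded n N → GLK n) (zariskiBounded n N)

/-- The Zariski topology on the affine Grassmannian, the quotient topology with respect to
`GL_n(K) → GL_n(K) / GL_n(O)`. -/
instance : TopologicalSpace (Gr n) := TopologicalSpace.coinduced Gr.mk (zariskiLoop n)

variable {n}

/-! ### Generalized affine Springer fibers -/

/-- The generalized affine Springer fiber `M_v = {[g] | g⁻¹ · v ∈ N(O)}` of `v ∈ N(K)`, as a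
subspace of the affine Grassmannian. -/
def M (v : NK n) : Set (Gr n) := {p | ∃ g : GLK n, Gr.mk g = p ∧ IsIntegral (adV g⁻¹ v)}

/-- The stabilizer `L_v` of `v` in `(GL_n × ℂˣ_dil)_K^O ⋊ ℂˣ_rot`. -/
abbrev L (v : NK n) : Subgroup (Ghat n) := MulAction.stabilizer (Ghat n) v

theorem IsIntegral.dil {s : NK n} (hs : IsIntegral s) (u : Oˣ) : IsIntegral (dil u s) :=
  ⟨fun i j => mul_mem ⟨_, rfl⟩ (hs.1 i j), hs.2⟩

theorem IsIntegral.rotN {s : NK n} (hs : IsIntegral s) (l : ℂˣ) : IsIntegral (rotN l s) := by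
  refine ⟨fun i j => ?_, fun i => ?_⟩
  · obtain ⟨a, ha⟩ := hs.1 i j
    exact ⟨rotO l a, by rw [← rot_toK, ha]; rfl⟩
  · obtain ⟨a, ha⟩ := hs.2 i
    exact ⟨rotO l a, by rw [← rot_toK, ha]; rfl⟩

theorem smul_mem_M {v : NK n} {x : Ghat n} (hx : x ∈ L v) {p : Gr n} (hp : p ∈ M v) :
    x • p ∈ M v := by
  obtain ⟨h, rfl, hh⟩ := hp
  refine ⟨x.left.1 * rotGL n x.right h, rfl, ?_⟩
  have hv : adV x.left.1 (AffSpringer.dil x.left.2 (AffSpringer.rotN x.right v)) = v := hx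
  have key : adV (x.left.1 * rotGL n x.right h)⁻¹ v =
      AffSpringer.dil x.left.2 (AffSpringer.rotN x.right (adV h⁻¹ v)) := by
    conv_lhs => rw [← hv]
    rw [← adV_mul, mul_inv_rev, inv_mul_cancel_right, rotN_adV, dil_adV, map_inv]
  rw [key]
  exact (hh.rotN _).dil _

/-- The action of `L_v` on `M_v`. -/
instance (v : NK n) : MulAction (L v) (M v) where
  smul x p := ⟨(x : Ghat n) • (p : Gr n), smul_mem_M x.2 p.2⟩
  one_smul p := Subtype.ext (one_smul (Ghat n) (p : Gr n))
  mul_smul x y p := Subtype.ext (mul_smul (x : Ghat n) (y : Ghat n) (p : Gr n))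

/-! ### The vector attached to a plane curve -/

/-- The polynomial `f = x^n - t^k` in `O[x]`. -/
def curve (n k : ℕ) : Polynomial O := Polynomial.X ^ n - Polynomial.C (PowerSeries.X ^ k)

/-- The companion matrix of `x^n - a_{n-1} x^{n-1} - ⋯ - a_0`: its first row is
`a_{n-1}, …, a_0`, it has ones below the diagonal and zeros elsewhere. With `i`, `j` running from
`0` to `n - 1`, the entry `a_{n-1-j}` of the first row is minus a coefficient of the polynomial. -/
def companion (n : ℕ) (f : Polynomial O) : Matrix (Fin n) (Fin n) K :=
  Matrix.of fun i j => (if i.val = 0 then toK (-f.coeff (n - 1 - j.val)) else 0) +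
    (if i.val = j.val + 1 then 1 else 0)

/-- The vector `v = (γ, e_1)` for `f = x^n - t^k`. -/
def v (n k : ℕ) [NeZero n] : NK n := (companion n (curve n k), Pi.single 0 1)

/-! ### Cocharacters and weights of the diagonal torus of `GL_n` -/

/-- Cocharacters of the diagonal torus `T ⊂ GL_n`: `A` is `s ↦ diag(s^{A_1}, …, s^{A_n})`. -/
abbrev Cocharacter (n : ℕ) : Type := Fin n → ℤ

/-- Weights of `T`: `w` is the character `diag(s_1, …, s_n) ↦ s_1^{w_1} ⋯ s_n^{w_n}`. -/
abbrev Weight (n : ℕ) : Type := Fin n → ℤ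

/-- The pairing `⟨A, w⟩` of cocharacters and weights. -/
def pairing (A : Cocharacter n) (w : Weight n) : ℤ := ∑ i, A i * w i

/-- The fundamental weight `ω_1`, the highest weight of the standard representation. -/
def omega1 (n : ℕ) [NeZero n] : Weight n := Pi.single 0 1

/-- The simple roots `α_1, …, α_{n-1}`, where `α_i` is the weight of the matrix entry
`(i, i + 1)`. -/
def simpleRoot (n : ℕ) (i : Fin (n - 1)) : Weight n :=
  Pi.single ⟨i.val, by omega⟩ 1 - Pi.single ⟨i.val + 1, by omega⟩ 1

/-- The homomorphism `s ↦ diag(s^{A_1}, …, s^{A_n})` on `K`-points given by the cocharacter `A`. -/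
def Cocharacter.eval (A : Cocharacter n) : Kˣ →* GLK n where
  toFun s :=
    ⟨Matrix.diagonal fun i => ((s ^ A i : Kˣ) : K), Matrix.diagonal fun i => ((s ^ (-A i) : Kˣ) : K),
      by simp [Matrix.diagonal_mul_diagonal, ← Matrix.diagonal_one,
        -Units.val_zpow_eq_zpow_val],
      by simp [Matrix.diagonal_mul_diagonal, ← Matrix.diagonal_one,
        -Units.val_zpow_eq_zpow_val]⟩
  map_one' := Units.ext (by simp)
  map_mul' s s' := Units.ext (by simp [Matrix.diagonal_mul_diagonal, mul_zpow])

/-- The point `[t^{-A}]` of the affine Grassmannian. -/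
def tPoint (A : Cocharacter n) : Gr n := Gr.mk (A.eval t)⁻¹

/-- The cocharacters `A` with `⟨A, ω_1⟩ ≥ 0`, `⟨A, α_i⟩ ≤ 0` for all `i`, and
`∑ i, ⟨A, α_i⟩ ≥ -k`. -/
def labels (n k : ℕ) [NeZero n] : Set (Cocharacter n) :=
  {A | 0 ≤ pairing A (omega1 n) ∧ (∀ i, pairing A (simpleRoot n i) ≤ 0) ∧
    -(k : ℤ) ≤ ∑ i, pairing A (simpleRoot n i)}

end AffSpringer

end

/-!
A point of `M_v` is a lattice `Λ = g O^n` with `γ Λ ⊆ Λ` and `e_1 ∈ Λ`.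

Fixed points. For `s ∈ ℂˣ` the element `(diag(1, s^{-k}, …, s^{-(n-1)k}), s^k, s^{-n})` stabilizes
`v` and scales the monomial vector `t^m e_{i+1}` (`0 ≤ i < n`) by `s^{-(ki+nm)}`. Since `n` and `k`
are coprime, these weights are pairwise distinct when `s` is not a root of unity. A fixed lattice
lies between `t^N O^n` and `t^{-N} O^n` for some `N`, so projecting to the weight spaces in the
finite-dimensional quotient shows that it contains every monomial vector occurring in one of its
elements (`single_mem_of_coeff_ne_zero`), and therefore it equals `t^{-A} O^n` for some `A`
(`exists_tPoint_eq_mk`). Conversely, `v` is cyclic, which forces the `GL_n`-component of an element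
`(g, μ, λ)` of the stabilizer to be `diag(1, μ⁻¹, …, μ^{-(n-1)})` (`left_apply_of_mem_L`), and so
the stabilizer fixes every `[t^{-A}]` (`smul_tPoint`). The entries of `t^A γ t^{-A}` and `t^A e_1`
are integral exactly under the inequalities that define the labels (`tPoint_mem_M_iff`).

Discreteness. Every set of points `[t^{-A}]` is closed in the affine Grassmannian
(`isClosed_tPoint_image`). Indeed `[g] = [t^{-A}]` means that `t^A g` and `g⁻¹ t^{-A}` are
integral, that is, that certain coordinates of `g` vanish; and comparing pole orders in
`g g⁻¹ = 1` shows that only finitely many `A` occur on each of the closed pieces on which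
`g` and `g⁻¹` have poles of order at most `N`. So every set of fixed points is closed.
-/

open scoped Topology

noncomputable section

namespace AffSpringer

/-! ### Integral Laurent series and the group `GL_n(O)` -/

theorem coe_t_zpow (a : ℤ) : ((t ^ a : Kˣ) : K) = HahnSeries.single a 1 := by
  rw [Units.val_zpow_eq_zpow_val]
  exact (RatFunc.single_zpow a).symm

theorem coeff_t_zpow_mul (a m : ℤ) (f : K) :
    (((t ^ a : Kˣ) : K) * f).coeff m = f.coeff (m - a) := by
  rw [coe_t_zpow, HahnSeries.coeff_single_mul, one_mul]

theorem mem_range_toK_iff {f : K} : f ∈ toK.range ↔ ∀ m < 0, f.coeff m = 0 := by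
  constructor
  · rintro ⟨a, rfl⟩ m hm
    change HahnSeries.coeff (HahnSeries.ofPowerSeries ℤ ℂ a) m = 0
    rw [PowerSeries.coeff_coe, if_pos hm]
  · intro h
    refine ⟨PowerSeries.mk fun m => f.coeff m, ?_⟩
    ext m
    change HahnSeries.coeff (HahnSeries.ofPowerSeries ℤ ℂ _) m = _
    rw [PowerSeries.coeff_coe]
    split_ifs with hm
    · exact (h m hm).symm
    · rw [PowerSeries.coeff_mk, Int.natAbs_of_nonneg (not_lt.mp hm)]

theorem t_zpow_mul_mem_range_iff {f : K} {a : ℤ} :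
    ((t ^ a : Kˣ) : K) * f ∈ toK.range ↔ ∀ m < -a, f.coeff m = 0 := by
  simp only [mem_range_toK_iff, coeff_t_zpow_mul]
  exact ⟨fun h m hm => by simpa using h (m + a) (by omega), fun h m hm => h _ (by omega)⟩

theorem t_zpow_mem_range_iff {a : ℤ} : ((t ^ a : Kˣ) : K) ∈ toK.range ↔ 0 ≤ a := by
  rw [mem_range_toK_iff, coe_t_zpow]
  constructor
  · intro h
    by_contra ha
    simpa using h a (not_le.mp ha)
  · intro ha m hm
    exact HahnSeries.coeff_single_of_ne (by omega)

theorem exists_t_zpow_mul_mem_range (f : K) :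
    ∃ N : ℕ, ∀ a : ℤ, N ≤ a → ((t ^ a : Kˣ) : K) * f ∈ toK.range := by
  refine ⟨f.order.natAbs, fun a ha => t_zpow_mul_mem_range_iff.2 fun m hm => ?_⟩
  exact HahnSeries.coeff_eq_zero_of_lt_order (by omega)

theorem rot_mem_range {f : K} (l : ℂˣ) (hf : f ∈ toK.range) : rot l f ∈ toK.range := by
  obtain ⟨a, rfl⟩ := hf
  exact ⟨rotO l a, (rot_toK l a).symm⟩

variable {n : ℕ}

theorem mem_GLO_iff {g : GLK n} :
    g ∈ GLO n ↔ (∀ i j, g i j ∈ toK.range) ∧ ∀ i j, g⁻¹ i j ∈ toK.range := by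
  constructor
  · rintro ⟨a, rfl⟩
    refine ⟨fun i j => ⟨a i j, rfl⟩, fun i j => ⟨a⁻¹ i j, ?_⟩⟩
    rw [← map_inv]
    rfl
  · rintro ⟨h, h'⟩
    choose a ha using h
    choose b hb using h'
    have hinj : Function.Injective (toK.mapMatrix (m := Fin n)) := fun x y hxy =>
      Matrix.ext fun i j => FaithfulSMul.algebraMap_injective O K
        (congrFun (congrFun hxy i) j)
    have ea : toK.mapMatrix (Matrix.of a) = (g : Matrix (Fin n) (Fin n) K) :=
      Matrix.ext ha
    have eb : toK.mapMatrix (Matrix.of b) = ((g⁻¹ : GLK n) : Matrix (Fin n) (Fin n) K) :=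
      Matrix.ext hb
    refine ⟨⟨Matrix.of a, Matrix.of b, hinj ?_, hinj ?_⟩, Units.ext ea⟩
    · rw [map_mul, ea, eb, map_one, ← Units.val_mul, mul_inv_cancel, Units.val_one]
    · rw [map_mul, ea, eb, map_one, ← Units.val_mul, inv_mul_cancel, Units.val_one]

theorem mk_eq_mk_iff {g h : GLK n} : Gr.mk g = Gr.mk h ↔ g⁻¹ * h ∈ GLO n :=
  QuotientGroup.eq

theorem eval_t_mul_apply (A : Cocharacter n) (g : GLK n) (i j : Fin n) :
    (A.eval t * g) i j = ((t ^ A i : Kˣ) : K) * g i j := by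
  change ((Matrix.diagonal fun i => ((t ^ A i : Kˣ) : K)) * (g : Matrix (Fin n) (Fin n) K)) i j = _
  rw [Matrix.diagonal_mul]

theorem inv_eval_t_mul_apply (A : Cocharacter n) (g : GLK n) (i j : Fin n) :
    (A.eval t * g)⁻¹ i j = ((t ^ (-A j) : Kˣ) : K) * g⁻¹ i j := by
  rw [mul_inv_rev]
  change ((g⁻¹ : GLK n) * Matrix.diagonal fun i => ((t ^ (-A i) : Kˣ) : K)) i j = _
  rw [Matrix.mul_diagonal, mul_comm]

/-- The lattice `g O^n` equals `t^{-A} O^n` if and only if `t^A g` and `g⁻¹ t^{-A}` are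
integral. -/
theorem tPoint_eq_mk_iff {A : Cocharacter n} {g : GLK n} :
    tPoint A = Gr.mk g ↔ ∀ i j, ((t ^ A i : Kˣ) : K) * g i j ∈ toK.range ∧
      ((t ^ (-A j) : Kˣ) : K) * g⁻¹ i j ∈ toK.range := by
  rw [tPoint, mk_eq_mk_iff, inv_inv, mem_GLO_iff]
  simp only [eval_t_mul_apply, inv_eval_t_mul_apply, forall_and]

theorem tPoint_injective : Function.Injective (tPoint (n := n)) := by
  intro A B h
  rw [tPoint, tPoint, mk_eq_mk_iff, inv_inv, mem_GLO_iff] at h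
  have key : ∀ i, 0 ≤ A i + -B i ∧ 0 ≤ B i + -A i := fun i => by
    have h1 := h.1 i i
    have h2 := h.2 i i
    rw [eval_t_mul_apply] at h1
    rw [inv_eval_t_mul_apply, inv_inv] at h2
    change _ * Matrix.diagonal (fun i => ((t ^ (-B i) : Kˣ) : K)) i i ∈ _ at h1
    change _ * Matrix.diagonal (fun i => ((t ^ (B i) : Kˣ) : K)) i i ∈ _ at h2
    rw [Matrix.diagonal_apply_eq, ← Units.val_mul, ← zpow_add, t_zpow_mem_range_iff] at h1 h2
    omega
  funext i
  have := key i
  omega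

/-! ### Sets of points `[t^{-A}]` are closed -/

theorem isClosed_setOf_coord_eq_zero (N : ℕ) (c : Bool × Fin n × Fin n × ℤ) :
    IsClosed[zariskiBounded n N] {g : bounded n N | coord (g : GLK n) c = 0} := by
  rw [← @isOpen_compl_iff _ _ (zariskiBounded n N)]
  refine TopologicalSpace.GenerateOpen.basic _ ⟨MvPolynomial.X c, ?_⟩
  ext g
  simp

theorem isClosed_setOf_tPoint_eq (N : ℕ) (A : Cocharacter n) :
    IsClosed[zariskiBounded n N] {g : bounded n N | tPoint A = Gr.mk (g : GLK n)} := by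
  have : {g : bounded n N | tPoint A = Gr.mk (g : GLK n)} =
      ⋂ (i : Fin n) (j : Fin n),
        (⋂ (m : ℤ) (_ : m < -A i), {g : bounded n N | coord (g : GLK n) (false, i, j, m) = 0}) ∩
        ⋂ (m : ℤ) (_ : m < -(-A j)),
          {g : bounded n N | coord (g : GLK n) (true, i, j, m) = 0} := by
    ext g
    simp only [Set.mem_ofPred_eq, tPoint_eq_mk_iff, t_zpow_mul_mem_range_iff, Set.mem_iInter,
      Set.mem_inter_iff]
    rfl
  rw [this]
  let := zariskiBounded n N
  exact isClosed_iInter fun i => isClosed_iInter fun j => IsClosed.inter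
    (isClosed_iInter fun m => isClosed_iInter fun _ => isClosed_setOf_coord_eq_zero N _)
    (isClosed_iInter fun m => isClosed_iInter fun _ => isClosed_setOf_coord_eq_zero N _)

/-- Only finitely many of the points `[t^{-A}]` have a representative `g` such that `g` and `g⁻¹`
have poles of order at most `N`. -/
theorem mem_Icc_of_tPoint_eq {N : ℕ} {A : Cocharacter n} {g : GLK n} (hg : g ∈ bounded n N)
    (h : tPoint A = Gr.mk g) : A ∈ Set.Icc (fun _ => -(N : ℤ)) fun _ => (N : ℤ) := by
  rw [tPoint_eq_mk_iff] at h
  have hone (i : Fin n) : ∑ j, g i j * g⁻¹ j i = 1 := by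
    rw [← Matrix.mul_apply, Units.mul_inv, Matrix.one_apply_eq]
  -- If `t ^ a` divides every summand of `∑ j, g i j * g⁻¹ j i = 1`, then `t ^ a` divides `1`.
  have bound (i : Fin n) (a : ℤ)
      (hi : ∀ j, ((t ^ (-a) : Kˣ) : K) * (g i j * g⁻¹ j i) ∈ toK.range) : a ≤ 0 := by
    have := Subring.sum_mem toK.range fun j (_ : j ∈ Finset.univ) => hi j
    rw [← Finset.mul_sum, hone, mul_one, t_zpow_mem_range_iff] at this
    omega
  have hgN (i j : Fin n) : ((t ^ (N : ℤ) : Kˣ) : K) * g i j ∈ toK.range :=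
    t_zpow_mul_mem_range_iff.2 fun m hm => (hg i j m hm).1
  have hgN' (i j : Fin n) : ((t ^ (N : ℤ) : Kˣ) : K) * g⁻¹ i j ∈ toK.range :=
    t_zpow_mul_mem_range_iff.2 fun m hm => (hg i j m hm).2
  constructor
  · intro i
    have := bound i (-A i - N) fun j => by
      convert mul_mem (h i j).1 (hgN' j i) using 1
      rw [show -(-A i - (N : ℤ)) = A i + N by ring, zpow_add, Units.val_mul]
      ring
    change -(N : ℤ) ≤ A i
    omega
  · intro i
    have := bound i (A i - N) fun j => by
      convert mul_mem (hgN i j) (h j i).2 using 1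
      rw [show -(A i - (N : ℤ)) = N + -A i by ring, zpow_add, Units.val_mul]
      ring
    change A i ≤ (N : ℤ)
    omega

theorem isClosed_tPoint_image (S : Set (Cocharacter n)) : IsClosed (tPoint '' S) := by
  refine isClosed_coinduced.2 (isClosed_iSup_iff.2 fun N => isClosed_coinduced.2 ?_)
  have : Subtype.val ⁻¹' (Gr.mk ⁻¹' (tPoint '' S)) =
      ⋃ A ∈ S ∩ Set.Icc (fun _ => -(N : ℤ)) fun _ => (N : ℤ),
        {g : bounded n N | tPoint A = Gr.mk (g : GLK n)} := by
    ext g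
    simp only [Set.mem_preimage, Set.mem_image, Set.mem_iUnion, Set.mem_ofPred_eq, exists_prop]
    exact ⟨fun ⟨A, hA, h⟩ => ⟨A, ⟨hA, mem_Icc_of_tPoint_eq g.2 h⟩, h⟩,
      fun ⟨A, hA, h⟩ => ⟨A, hA.1, h⟩⟩
  rw [this]
  let := zariskiBounded n N
  exact ((Set.finite_Icc _ _).inter_of_right S).isClosed_biUnion fun A _ =>
    isClosed_setOf_tPoint_eq N A

/-! ### Integrality at the points `[t^{-A}]` -/

theorem isIntegral_adV {g : GLK n} (hg : g ∈ GLO n) {s : NK n} (hs : IsIntegral s) :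
    IsIntegral (adV g s) := by
  rw [mem_GLO_iff] at hg
  refine ⟨fun i j => ?_, fun i => ?_⟩
  · simp only [adV, Matrix.mul_apply]
    exact sum_mem fun a _ => mul_mem (sum_mem fun b _ => mul_mem (hg.1 _ _) (hs.1 _ _)) (hg.2 _ _)
  · change ∑ a, g i a * s.2 a ∈ _
    exact sum_mem fun a _ => mul_mem (hg.1 _ _) (hs.2 _)

theorem mk_mem_M_iff {v : NK n} {g : GLK n} : Gr.mk g ∈ M v ↔ IsIntegral (adV g⁻¹ v) := by
  refine ⟨fun ⟨h, hhg, hv⟩ => ?_, fun h => ⟨g, rfl, h⟩⟩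
  have := isIntegral_adV (mk_eq_mk_iff.1 hhg.symm) hv
  rwa [← adV_mul, mul_inv_cancel_right] at this

theorem adV_eval_fst (A : Cocharacter n) (u : Kˣ) (s : NK n) (i j : Fin n) :
    (adV (A.eval u) s).1 i j = ((u ^ A i : Kˣ) : K) * s.1 i j * ((u ^ (-A j) : Kˣ) : K) := by
  change (Matrix.diagonal (fun i => ((u ^ A i : Kˣ) : K)) * s.1 *
    Matrix.diagonal (fun i => ((u ^ (-A i) : Kˣ) : K))) i j = _
  rw [Matrix.mul_diagonal, Matrix.diagonal_mul]

theorem adV_eval_snd (A : Cocharacter n) (u : Kˣ) (s : NK n) (i : Fin n) :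
    (adV (A.eval u) s).2 i = ((u ^ A i : Kˣ) : K) * s.2 i := by
  change (Matrix.diagonal (fun i => ((u ^ A i : Kˣ) : K)) *ᵥ s.2) i = _
  rw [Matrix.mulVec_diagonal]

theorem toK_X_pow (k : ℕ) : toK (PowerSeries.X ^ k) = ((t ^ (k : ℤ) : Kˣ) : K) := by
  rw [map_pow, zpow_natCast, Units.val_pow_eq_pow_val]
  congr 1
  exact PowerSeries.coe_X

theorem companion_curve_apply (n k : ℕ) (i j : Fin n) :
    companion n (curve n k) i j =
      (if i.val = 0 ∧ j.val + 1 = n then ((t ^ (k : ℤ) : Kˣ) : K) else 0) +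
        if i.val = j.val + 1 then 1 else 0 := by
  have hj := j.isLt
  rw [companion, Matrix.of_apply]
  congr 1
  by_cases hi : i.val = 0
  · rw [if_pos hi, curve, Polynomial.coeff_sub, Polynomial.coeff_X_pow, if_neg (by omega),
      Polynomial.coeff_C]
    by_cases hjn : j.val + 1 = n
    · rw [if_pos (by omega), if_pos ⟨hi, hjn⟩, zero_sub, neg_neg, toK_X_pow]
    · rw [if_neg (by omega), if_neg (by tauto), sub_zero, neg_zero, map_zero]
  · rw [if_neg hi, if_neg (by tauto)]

theorem pairing_simpleRoot (A : Cocharacter n) (i : Fin (n - 1)) :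
    pairing A (simpleRoot n i) = A ⟨i.val, by omega⟩ - A ⟨i.val + 1, by omega⟩ := by
  simp [pairing, simpleRoot, mul_sub, Finset.sum_sub_distrib, Pi.single_apply]

section

variable [NeZero n]

theorem sum_pairing_simpleRoot (A : Cocharacter n) {l : Fin n} (hl : l.val + 1 = n) :
    ∑ i, pairing A (simpleRoot n i) = A 0 - A l := by
  let a : ℕ → ℤ := fun m => if h : m < n then A ⟨m, h⟩ else 0
  have ha (m : ℕ) (h : m < n) : a m = A ⟨m, h⟩ := dif_pos h
  calc ∑ i, pairing A (simpleRoot n i) = ∑ i : Fin (n - 1), (a i - a (i + 1)) :=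
        Finset.sum_congr rfl fun i _ => by rw [pairing_simpleRoot, ha, ha]
    _ = a 0 - a (n - 1) := by
        rw [Fin.sum_univ_eq_sum_range (fun m => a m - a (m + 1)), Finset.sum_range_sub']
    _ = A 0 - A l := by
        rw [ha 0 (NeZero.pos n), ha (n - 1) (by omega)]
        congr 2
        exact Fin.ext (by simp; omega)

theorem mem_labels_iff {k : ℕ} {A : Cocharacter n} :
    A ∈ labels n k ↔ 0 ≤ A 0 ∧ (∀ i j : Fin n, i.val = j.val + 1 → A j ≤ A i) ∧
      ∀ l : Fin n, l.val + 1 = n → A l ≤ A 0 + k := by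
  have hl : (⟨n - 1, Nat.sub_one_lt (NeZero.ne n)⟩ : Fin n).val + 1 = n :=
    Nat.sub_add_cancel (NeZero.one_le)
  have h0 : pairing A (omega1 n) = A 0 := by simp [pairing, omega1, Pi.single_apply]
  have hS (l : Fin n) (h : l.val + 1 = n) := sum_pairing_simpleRoot A h
  simp only [labels, Set.mem_ofPred_eq, h0, pairing_simpleRoot]
  simp only [pairing_simpleRoot] at hS
  refine and_congr Iff.rfl (and_congr ⟨fun h i j hij => ?_, fun h i => ?_⟩
    ⟨fun h l hl => ?_, fun h => ?_⟩)
  · have := h ⟨j.val, by omega⟩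
    have e : i = ⟨j.val + 1, by omega⟩ := Fin.ext hij
    rw [e]
    exact sub_nonpos.1 this
  · exact sub_nonpos.2 (h _ _ rfl)
  · rw [hS l hl] at h
    omega
  · rw [hS _ hl]
    have := h _ hl
    omega

theorem tPoint_mem_M_iff {k : ℕ} {A : Cocharacter n} :
    tPoint A ∈ M (v n k) ↔ A ∈ labels n k := by
  rw [tPoint, mk_mem_M_iff, inv_inv, mem_labels_iff, IsIntegral, and_comm]
  simp only [adV_eval_fst, adV_eval_snd, v, companion_curve_apply]
  refine and_congr ⟨fun h => ?_, fun h i => ?_⟩ ⟨fun h => ⟨fun i j hij => ?_, fun l hl => ?_⟩,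
    fun h i j => ?_⟩
  · simpa only [Pi.single_eq_same, mul_one, t_zpow_mem_range_iff] using h 0
  · by_cases hi : i = 0
    · rw [hi, Pi.single_eq_same, mul_one]
      exact t_zpow_mem_range_iff.2 h
    · rw [Pi.single_eq_of_ne hi, mul_zero]
      exact zero_mem _
  · have := h i j
    rw [if_neg (by omega), if_pos hij, zero_add, mul_one, ← Units.val_mul, ← zpow_add,
      t_zpow_mem_range_iff] at this
    omega
  · have := h 0 l
    rw [if_pos ⟨rfl, hl⟩, if_neg (by simp), add_zero, ← Units.val_mul, ← Units.val_mul, ← zpow_add,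
      ← zpow_add, t_zpow_mem_range_iff] at this
    omega
  · rw [mul_add, add_mul]
    refine add_mem ?_ ?_
    · split_ifs with hij
      · rw [← Units.val_mul, ← Units.val_mul, ← zpow_add, ← zpow_add, t_zpow_mem_range_iff]
        have := h.2 j hij.2
        have e : i = 0 := Fin.ext hij.1
        rw [e]
        omega
      · rw [mul_zero, zero_mul]
        exact zero_mem _
    · split_ifs with hij
      · rw [mul_one, ← Units.val_mul, ← zpow_add, t_zpow_mem_range_iff]
        have := h.1 i j hij
        omega
      · rw [mul_zero, zero_mul]
        exact zero_mem _

/-! ### The stabilizer fixes the points `[t^{-A}]` -/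

/-- An element of the stabilizer commutes with `γ` up to the unit `μ` and fixes the cyclic vector
`e_1`; hence it scales `γ^j e_1` by `μ^{-j}`. -/
theorem left_apply_of_mem_L {k : ℕ} {x : Ghat n} (hx : x ∈ L (v n k)) (j i : Fin n) :
    x.left.1 i j = if i = j then toK ((x.left.2⁻¹ ^ j.val : Oˣ) : O) else 0 := by
  have hx' : adV x.left.1 (dil x.left.2 (rotN x.right (v n k))) = v n k := hx
  set g := x.left.1
  set μ := x.left.2
  have hvec : (g : Matrix (Fin n) (Fin n) K) *ᵥ (fun i => rot x.right ((v n k).2 i)) =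
    (v n k).2 := congrArg Prod.snd hx'
  have hmat : (g : Matrix (Fin n) (Fin n) K) *
      (dil μ (rotN x.right (v n k))).1 = (v n k).1 * (g : Matrix (Fin n) (Fin n) K) := by
    rw [← Units.mul_inv_eq_iff_eq_mul]
    exact congrArg Prod.fst hx'
  obtain ⟨j, hj⟩ := j
  induction j generalizing i with
  | zero =>
    have h0 : (⟨0, hj⟩ : Fin n) = 0 := rfl
    have h1 : (fun i => rot x.right ((v n k).2 i)) = Pi.single 0 1 := by
      funext i
      by_cases hi : i = 0
      · subst hi
        simp [v]
      · simp [v, hi]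
    rw [h1, Matrix.mulVec_single_one] at hvec
    have := congrFun hvec i
    rw [h0]
    rw [Matrix.col_apply] at this
    rw [this]
    simp [v, Pi.single_apply]
  | succ j ih =>
    have hj' : j < n := by omega
    have hcol (a : Fin n) : companion n (curve n k) a ⟨j, hj'⟩ =
        if a = ⟨j + 1, hj⟩ then 1 else 0 := by
      rw [companion_curve_apply, if_neg (by simp; omega), zero_add]
      simp [Fin.ext_iff]
    have hij := congrFun (congrFun hmat i) ⟨j, hj'⟩
    rw [Matrix.mul_apply, Matrix.mul_apply] at hij
    -- Column `j` of `g (μ γ(λ t)) = γ g`, with `γ e_j = e_{j+1}`.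
    have hL : ∑ a, g i a * (dil μ (rotN x.right (v n k))).1 a ⟨j, hj'⟩ =
        g i ⟨j + 1, hj⟩ * toK (μ : O) := by
      rw [Finset.sum_eq_single ⟨j + 1, hj⟩ _ (by simp)]
      · change _ * (_ * rot x.right (companion n (curve n k) _ _)) = _
        rw [hcol, if_pos rfl, map_one, mul_one]
      · intro a _ ha
        change _ * (_ * rot x.right (companion n (curve n k) _ _)) = _
        rw [hcol, if_neg ha, map_zero, mul_zero, mul_zero]
    have hR : ∑ a, (v n k).1 i a * g a ⟨j, hj'⟩ =
        (if i = ⟨j + 1, hj⟩ then 1 else 0) * toK ((μ⁻¹ ^ j : Oˣ) : O) := by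
      rw [Finset.sum_eq_single ⟨j, hj'⟩ _ (by simp)]
      · rw [ih, if_pos rfl]
        change companion n (curve n k) _ _ * _ = _
        rw [hcol]
      · intro a _ ha
        rw [ih, if_neg ha, mul_zero]
    have hμ : toK (μ : O) * toK ((μ⁻¹ : Oˣ) : O) = 1 := by
      rw [← map_mul, Units.mul_inv, map_one]
    calc g i ⟨j + 1, hj⟩ = (g i ⟨j + 1, hj⟩ * toK (μ : O)) * toK ((μ⁻¹ : Oˣ) : O) := by
          rw [mul_assoc, hμ, mul_one]
      _ = _ := by
          rw [← hL, hij, hR, pow_succ, Units.val_mul, map_mul]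
          split_ifs <;> simp

theorem rot_t_zpow (l : ℂˣ) (a : ℤ) :
    rot l ((t ^ a : Kˣ) : K) = toK (PowerSeries.C ((l ^ a : ℂˣ) : ℂ)) * ((t ^ a : Kˣ) : K) := by
  ext m
  change ((l ^ m : ℂˣ) : ℂ) * _ = (HahnSeries.ofPowerSeries ℤ ℂ _ * _ : K).coeff m
  rw [PowerSeries.coe_C, HahnSeries.C_apply, HahnSeries.coeff_single_mul, sub_zero, coe_t_zpow]
  by_cases h : m = a
  · rw [h]
  · rw [HahnSeries.coeff_single_of_ne h, mul_zero, mul_zero]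

theorem smul_tPoint {k : ℕ} {x : Ghat n} (hx : x ∈ L (v n k)) (A : Cocharacter n) :
    x • tPoint A = tPoint A := by
  let d : Fin n → Oˣ := fun j => x.left.2⁻¹ ^ j.val *
    Units.map (PowerSeries.C (R := ℂ)).toMonoidHom (x.right ^ (-A j))
  let D : GL (Fin n) O := Units.map (Matrix.diagonalRingHom (Fin n) O).toMonoidHom
    (MulEquiv.piUnits.symm d)
  refine (mk_eq_mk_iff.2 (?_ : ((A.eval t)⁻¹)⁻¹ * (x.left.1 * rotGL n x.right (A.eval t)⁻¹) ∈
    GLO n)).symm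
  refine ⟨D, Units.ext (Matrix.ext fun i j => ?_)⟩
  rw [inv_inv, eval_t_mul_apply]
  have h : (x.left.1 * rotGL n x.right (A.eval t)⁻¹) i j =
      x.left.1 i j * rot x.right ((t ^ (-A j) : Kˣ) : K) := by
    change (∑ a, x.left.1 i a * rot x.right
      (Matrix.diagonal (fun i => ((t ^ (-A i) : Kˣ) : K)) a j)) = _
    rw [Finset.sum_eq_single j _ (by simp), Matrix.diagonal_apply_eq]
    intro a _ ha
    rw [Matrix.diagonal_apply_ne _ ha, map_zero, mul_zero]
  rw [h, left_apply_of_mem_L hx, rot_t_zpow]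
  change toK (Matrix.diagonal (fun j => ((d j : Oˣ) : O)) i j) = _
  by_cases hij : i = j
  · subst hij
    rw [if_pos rfl, Matrix.diagonal_apply_eq]
    have ht : ((t ^ A i : Kˣ) : K) * ((t ^ (-A i) : Kˣ) : K) = 1 := by
      rw [← Units.val_mul, ← zpow_add, add_neg_cancel, zpow_zero, Units.val_one]
    rw [Units.val_mul, map_mul]
    change _ * toK (PowerSeries.C ((x.right ^ (-A i) : ℂˣ) : ℂ)) = _
    linear_combination (-(toK ((x.left.2⁻¹ ^ i.val : Oˣ) : O) *
      toK (PowerSeries.C ((x.right ^ (-A i) : ℂˣ) : ℂ)))) * ht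
  · rw [if_neg hij, Matrix.diagonal_apply_ne _ hij, map_zero, zero_mul, mul_zero]

end

/-! ### A one-parameter subgroup of the stabilizer -/

/-- The inclusion of the constants `ℂˣ → Kˣ`. -/
def const : ℂˣ →* Kˣ := Units.map (algebraMap O K |>.comp (PowerSeries.C (R := ℂ))).toMonoidHom

theorem coeff_const_mul (s : ℂˣ) (f : K) (m : ℤ) :
    ((const s : K) * f).coeff m = s * f.coeff m := by
  change (HahnSeries.ofPowerSeries ℤ ℂ _ * _ : K).coeff m = _
  rw [PowerSeries.coe_C, HahnSeries.C_apply, HahnSeries.coeff_single_mul, sub_zero]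

theorem rot_t_zpow_eq_val (l : ℂˣ) (a : ℤ) :
    rot l ((t ^ a : Kˣ) : K) = ((const (l ^ a) * t ^ a : Kˣ) : K) := rot_t_zpow l a

variable (n) (k : ℕ)

/-- The element `(diag(1, s^{-k}, …, s^{-(n-1)k}), s^k, s^{-n})` of the group
`(GL_n × ℂˣ_dil)_K^O ⋊ ℂˣ_rot`. It stabilizes the vector `v`, and it scales the monomial vector
`t^m e_{i+1}` by `s^{-(ki+nm)}`. -/
def torusElement (s : ℂˣ) : Ghat n where
  left := (Cocharacter.eval (fun i : Fin n => -((k : ℤ) * i.val)) (const s),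
    Units.map (PowerSeries.C (R := ℂ)).toMonoidHom (s ^ (k : ℤ)))
  right := s ^ (-(n : ℤ))

theorem torusElement_mem_L [NeZero n] (s : ℂˣ) : torusElement n k s ∈ L (v n k) := by
  change adV (Cocharacter.eval (fun i : Fin n => -((k : ℤ) * i.val)) (const s))
    (dil (Units.map (PowerSeries.C (R := ℂ)).toMonoidHom (s ^ (k : ℤ)))
      (rotN (s ^ (-(n : ℤ))) (v n k))) = v n k
  refine Prod.ext (Matrix.ext fun i j => ?_) (funext fun i => ?_)
  · rw [adV_eval_fst]
    change _ * (((const (s ^ (k : ℤ)) : Kˣ) : K) *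
      rot (s ^ (-(n : ℤ))) (companion n (curve n k) i j)) * _ = companion n (curve n k) i j
    have key (e : ℤ) (u : Kˣ) (he : (k : ℤ) * j.val - k * i.val + k + e = 0) :
        ((const s ^ (-((k : ℤ) * i.val)) : Kˣ) : K) * (((const (s ^ (k : ℤ)) : Kˣ) : K) *
          ((const (s ^ e) * u : Kˣ) : K)) * ((const s ^ (- -((k : ℤ) * j.val)) : Kˣ) : K) =
          (u : K) := by
      rw [map_zpow, map_zpow, ← Units.val_mul, ← Units.val_mul, ← Units.val_mul]
      congr 1
      calc _ = const s ^ ((k : ℤ) * j.val - k * i.val + k + e) * u := by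
            rw [zpow_add, zpow_add, sub_eq_add_neg, zpow_add, neg_neg]
            refine Units.ext ?_
            simp only [Units.val_mul]
            ring
        _ = u := by rw [he, zpow_zero, one_mul]
    rw [companion_curve_apply, map_add, mul_add, mul_add, add_mul]
    congr 1
    · split_ifs with hij
      · rw [rot_t_zpow_eq_val, ← zpow_mul]
        refine key _ _ ?_
        have h1 : (n : ℤ) = j.val + 1 := by exact_mod_cast hij.2.symm
        rw [hij.1, h1]
        push_cast
        ring
      · simp
    · split_ifs with hij
      · rw [map_one]
        have := key 0 1 (by rw [hij]; push_cast; ring)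
        simpa using this
      · simp
  · rw [adV_eval_snd]
    change _ * rot _ ((v n k).2 i) = _
    by_cases hi : i = 0
    · subst hi
      simp [v]
    · simp [v, hi]

variable {n k}

/-! ### Lattices -/

/-- The lattice `g O^n` in `K^n`, as a complex vector space. -/
def lattice (g : GLK n) : Submodule ℂ (Fin n → K) where
  carrier := {w | ∀ i, ((↑g⁻¹ : Matrix (Fin n) (Fin n) K) *ᵥ w) i ∈ toK.range}
  zero_mem' i := by
    rw [Matrix.mulVec_zero]
    exact zero_mem _
  add_mem' hx hy i := by
    rw [Matrix.mulVec_add]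
    exact add_mem (hx i) (hy i)
  smul_mem' c w hw i := by
    have : ((↑g⁻¹ : Matrix (Fin n) (Fin n) K) *ᵥ (c • w)) i =
        HahnSeries.single 0 c * ((↑g⁻¹ : Matrix (Fin n) (Fin n) K) *ᵥ w) i := by
      change ∑ j, _ * (c • w j) = _ * ∑ j, _ * w j
      rw [Finset.mul_sum]
      refine Finset.sum_congr rfl fun j _ => ?_
      rw [← HahnSeries.single_zero_mul_eq_smul]
      ring
    rw [this]
    exact mul_mem ⟨PowerSeries.C c, PowerSeries.coe_C c⟩ (hw i)

theorem mem_lattice_iff {g : GLK n} {w : Fin n → K} :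
    w ∈ lattice g ↔ ∀ i, ((↑g⁻¹ : Matrix (Fin n) (Fin n) K) *ᵥ w) i ∈ toK.range := Iff.rfl

theorem mulVec_rot_mem_lattice {x : Ghat n} {h : GLK n} (hx : x • Gr.mk h = Gr.mk h)
    {w : Fin n → K} (hw : w ∈ lattice h) :
    ((x.left.1 : Matrix (Fin n) (Fin n) K) *ᵥ fun i => rot x.right (w i)) ∈ lattice h := by
  have hq : h⁻¹ * (x.left.1 * rotGL n x.right h) ∈ GLO n := mk_eq_mk_iff.1 hx.symm
  have hrot : ((rotGL n x.right h : GLK n) : Matrix (Fin n) (Fin n) K) *ᵥ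
      (fun i => rot x.right (((↑h⁻¹ : Matrix (Fin n) (Fin n) K) *ᵥ w) i)) =
      fun i => rot x.right (w i) := by
    have := congrArg Prod.snd (rotN_adV x.right h (0, (↑h⁻¹ : Matrix (Fin n) (Fin n) K) *ᵥ w))
    refine this.symm.trans (funext fun i => ?_)
    change rot x.right (((h : Matrix (Fin n) (Fin n) K) *ᵥ
      ((↑h⁻¹ : Matrix (Fin n) (Fin n) K) *ᵥ w)) i) = _
    rw [Matrix.mulVec_mulVec, Units.mul_inv, Matrix.one_mulVec]
  intro i
  rw [← hrot, Matrix.mulVec_mulVec, Matrix.mulVec_mulVec, ← Units.val_mul, ← Units.val_mul,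
    mul_assoc]
  rw [Matrix.mulVec, dotProduct]
  exact sum_mem fun j _ => mul_mem ((mem_GLO_iff.1 hq).1 i j) (rot_mem_range _ (hw j))

theorem coeff_torusElement_mulVec (s : ℂˣ) (w : Fin n → K) (i : Fin n) (m : ℤ) :
    ((((torusElement n k s).left.1 : Matrix (Fin n) (Fin n) K) *ᵥ fun i =>
      rot (torusElement n k s).right (w i)) i).coeff m =
      ((s ^ (-((k : ℤ) * i.val + n * m)) : ℂˣ) : ℂ) * (w i).coeff m := by
  change ((Matrix.diagonal (fun i : Fin n => ((const s ^ (-((k : ℤ) * i.val)) : Kˣ) : K)) *ᵥ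
    fun i => rot (s ^ (-(n : ℤ))) (w i)) i).coeff m = _
  rw [Matrix.mulVec_diagonal, ← map_zpow, coeff_const_mul]
  change _ * ((((s ^ (-(n : ℤ))) ^ m : ℂˣ) : ℂ) * _) = _
  rw [← mul_assoc, ← Units.val_mul, ← zpow_mul, ← zpow_add]
  congr 4
  ring

/-- Applying `∏_{p ∈ P} (φ - c p)` to a vector of a subspace that is stable under an operator `φ`
which acts on monomial vectors by scalars `c`. -/
theorem exists_mem_coeff_eq_prod_mul (V : Submodule ℂ (Fin n → K)) (c : Fin n × ℤ → ℂ)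
    (φ : (Fin n → K) → Fin n → K)
    (hφ : ∀ w i m, (φ w i).coeff m = c (i, m) * (w i).coeff m) (hV : ∀ w ∈ V, φ w ∈ V)
    (P : Finset (Fin n × ℤ)) {w : Fin n → K} (hw : w ∈ V) :
    ∃ w' ∈ V, ∀ i m, (w' i).coeff m = (∏ p ∈ P, (c (i, m) - c p)) * (w i).coeff m := by
  induction P using Finset.induction_on with
  | empty => exact ⟨w, hw, by simp⟩
  | insert p P hp ih =>
    obtain ⟨w', hw', h⟩ := ih
    refine ⟨φ w' - c p • w', sub_mem (hV _ hw') (V.smul_mem _ hw'), fun i m => ?_⟩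
    rw [Pi.sub_apply, HahnSeries.coeff_sub, hφ, Pi.smul_apply, HahnSeries.coeff_smul, smul_eq_mul,
      h, Finset.prod_insert hp]
    ring

/-- A subspace between `t^N O^n` and `t^{-N} O^n` that is stable under an operator acting on the
monomial vectors by distinct scalars contains every monomial that occurs in one of its elements. -/
theorem single_mem_of_coeff_ne_zero (V : Submodule ℂ (Fin n → K)) (c : Fin n × ℤ → ℂ)
    (hc : Function.Injective c) (φ : (Fin n → K) → Fin n → K)
    (hφ : ∀ w i m, (φ w i).coeff m = c (i, m) * (w i).coeff m) (hV : ∀ w ∈ V, φ w ∈ V) (N : ℤ)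
    (hlow : ∀ w : Fin n → K, (∀ i, ∀ m < N, (w i).coeff m = 0) → w ∈ V)
    (hup : ∀ w ∈ V, ∀ i, ∀ m < -N, (w i).coeff m = 0)
    {w : Fin n → K} (hw : w ∈ V) {i : Fin n} {m : ℤ} (him : (w i).coeff m ≠ 0) :
    Pi.single i ((t ^ m : Kˣ) : K) ∈ V := by
  obtain ⟨w', hw', h⟩ := exists_mem_coeff_eq_prod_mul V c φ hφ hV
    ((Finset.univ ×ˢ Finset.Ico (-N) N).erase (i, m)) hw
  have hne : (w' i).coeff m ≠ 0 := by
    rw [h]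
    refine mul_ne_zero (Finset.prod_ne_zero_iff.2 fun p hp => ?_) him
    exact sub_ne_zero.2 (hc.ne (Finset.ne_of_mem_erase hp).symm)
  have hz (j : Fin n) (l : ℤ) (hl : l < N) (hjl : (j, l) ≠ (i, m)) : (w' j).coeff l = 0 := by
    rcases lt_or_ge l (-N) with hl' | hl'
    · exact hup w' hw' j l hl'
    · rw [h, Finset.prod_eq_zero (i := (j, l)), zero_mul]
      · exact Finset.mem_erase.2 ⟨hjl, by simp [hl, hl']⟩
      · exact sub_self _
  rw [← V.smul_mem_iff hne]
  rw [← sub_sub_cancel w' (_ • _)]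
  refine sub_mem hw' (hlow _ fun j l hl => ?_)
  rw [Pi.sub_apply, Pi.smul_apply, HahnSeries.coeff_sub, HahnSeries.coeff_smul, smul_eq_mul]
  by_cases hj : j = i
  · subst hj
    rw [Pi.single_eq_same, coe_t_zpow]
    by_cases hlm : l = m
    · subst hlm
      simp
    · rw [hz _ _ hl (by simpa using hlm), HahnSeries.coeff_single_of_ne hlm, mul_zero, sub_zero]
  · rw [hz _ _ hl (by simp [hj]), Pi.single_eq_of_ne hj]
    simp

theorem exists_mem_bounded (g : GLK n) : ∃ N, g ∈ bounded n N := by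
  have h (f : K) : ∀ᶠ N : ℕ in Filter.atTop, ((t ^ (N : ℤ) : Kˣ) : K) * f ∈ toK.range := by
    obtain ⟨N, hN⟩ := exists_t_zpow_mul_mem_range f
    filter_upwards [Filter.eventually_ge_atTop N] with a ha
    exact hN a (by exact_mod_cast ha)
  obtain ⟨N, hN⟩ := (Filter.eventually_all.2 fun i => Filter.eventually_all.2 fun j =>
    (h (g i j)).and (h (g⁻¹ i j))).exists
  exact ⟨N, fun i j m hm => ⟨t_zpow_mul_mem_range_iff.1 (hN i j).1 m hm,
    t_zpow_mul_mem_range_iff.1 (hN i j).2 m hm⟩⟩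

theorem t_zpow_mul_mulVec_mem_range {B : Matrix (Fin n) (Fin n) K} {w : Fin n → K} {a b : ℤ}
    (hB : ∀ i j, ((t ^ a : Kˣ) : K) * B i j ∈ toK.range)
    (hw : ∀ j, ((t ^ b : Kˣ) : K) * w j ∈ toK.range) (i : Fin n) :
    ((t ^ (a + b) : Kˣ) : K) * (B *ᵥ w) i ∈ toK.range := by
  change _ * ∑ j, B i j * w j ∈ _
  rw [Finset.mul_sum]
  refine sum_mem fun j _ => ?_
  convert mul_mem (hB i j) (hw j) using 1
  rw [zpow_add, Units.val_mul]
  ring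

/-- A lattice is spanned by monomial vectors as soon as it contains every monomial that occurs in
one of its elements. -/
theorem exists_tPoint_eq_mk (h : GLK n)
    (hmon : ∀ w ∈ lattice h, ∀ i m, (w i).coeff m ≠ 0 →
      Pi.single i ((t ^ m : Kˣ) : K) ∈ lattice h)
    (N : ℤ) (hlow : ∀ w : Fin n → K, (∀ i, ∀ m < N, (w i).coeff m = 0) → w ∈ lattice h)
    (hup : ∀ w ∈ lattice h, ∀ i, ∀ m < -N, (w i).coeff m = 0) :
    ∃ A : Cocharacter n, tPoint A = Gr.mk h := by
  have hleast (i : Fin n) : ∃ a : ℤ, Pi.single i ((t ^ a : Kˣ) : K) ∈ lattice h ∧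
      ∀ m, Pi.single i ((t ^ m : Kˣ) : K) ∈ lattice h → a ≤ m := by
    refine Int.exists_least_of_bdd ⟨-N, fun m hm => ?_⟩ ⟨N, hlow _ fun j m hm => ?_⟩
    · by_contra hlt
      have := hup _ hm i m (not_le.1 hlt)
      rw [Pi.single_eq_same, coe_t_zpow, HahnSeries.coeff_single_same] at this
      exact one_ne_zero this
    · by_cases hj : j = i
      · subst hj
        rw [Pi.single_eq_same, coe_t_zpow, HahnSeries.coeff_single_of_ne hm.ne]
      · rw [Pi.single_eq_of_ne hj, HahnSeries.coeff_zero]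
  choose a ha hmin using hleast
  refine ⟨fun i => -a i, tPoint_eq_mk_iff.2 fun i j => ⟨?_, ?_⟩⟩
  · rw [t_zpow_mul_mem_range_iff]
    intro m hm
    by_contra hne
    have hcol : (fun l => h l j) ∈ lattice h := by
      intro l
      change ((h⁻¹ : GLK n) * h : Matrix (Fin n) (Fin n) K) l j ∈ _
      rw [Units.inv_mul, Matrix.one_apply]
      split_ifs
      exacts [one_mem _, zero_mem _]
    have := hmin i m (hmon _ hcol i m hne)
    omega
  · have := mem_lattice_iff.1 (ha j) i
    rw [Matrix.mulVec_single, Pi.smul_apply, MulOpposite.smul_eq_mul_unop, Matrix.col_apply,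
      MulOpposite.unop_op, mul_comm] at this
    rwa [neg_neg]

/-- Every point fixed by the one-parameter subgroup `torusElement` is of the form `[t^{-A}]`. -/
theorem exists_tPoint_eq_of_smul_eq [NeZero n] (hnk : Nat.Coprime n k) (h : GLK n)
    (hfix : ∀ s, torusElement n k s • Gr.mk h = Gr.mk h) :
    ∃ A : Cocharacter n, tPoint A = Gr.mk h := by
  obtain ⟨N, hN⟩ := exists_mem_bounded h
  have hbd (i j : Fin n) : ((t ^ (N : ℤ) : Kˣ) : K) * h i j ∈ toK.range ∧
      ((t ^ (N : ℤ) : Kˣ) : K) * h⁻¹ i j ∈ toK.range :=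
    ⟨t_zpow_mul_mem_range_iff.2 fun m hm => (hN i j m hm).1,
      t_zpow_mul_mem_range_iff.2 fun m hm => (hN i j m hm).2⟩
  have hlow (w : Fin n → K) (hw : ∀ i, ∀ m < (N : ℤ), (w i).coeff m = 0) : w ∈ lattice h := by
    intro i
    have := t_zpow_mul_mulVec_mem_range (b := -(N : ℤ)) (fun i j => (hbd i j).2)
      (fun j => t_zpow_mul_mem_range_iff.2 fun m hm => hw j m (by omega)) i
    rwa [add_neg_cancel, zpow_zero, Units.val_one, one_mul] at this
  have hup (w : Fin n → K) (hw : w ∈ lattice h) (i : Fin n) (m : ℤ) (hm : m < -(N : ℤ)) :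
      (w i).coeff m = 0 := by
    have := t_zpow_mul_mulVec_mem_range (b := 0) (fun i j => (hbd i j).1)
      (w := (↑h⁻¹ : Matrix (Fin n) (Fin n) K) *ᵥ w)
      (fun j => by rw [zpow_zero, Units.val_one, one_mul]; exact hw j) i
    rw [Matrix.mulVec_mulVec, Units.mul_inv, Matrix.one_mulVec, add_zero] at this
    exact t_zpow_mul_mem_range_iff.1 this m hm
  refine exists_tPoint_eq_mk h (fun w hw i m hne => ?_) N hlow hup
  -- Any `s` that is not a root of unity separates the monomial vectors.
  let s : ℂˣ := Units.mk0 2 two_ne_zero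
  let c : Fin n × ℤ → ℂ := fun p => ((s ^ (-((k : ℤ) * p.1.val + n * p.2)) : ℂˣ) : ℂ)
  have hpow : Function.Injective fun e : ℤ => ((s ^ e : ℂˣ) : ℂ) := by
    intro e e' hee
    refine zpow_right_injective₀ (a := (2 : ℝ)) two_pos (by norm_num) ?_
    have := congrArg norm hee
    simpa [s] using this
  have hc : Function.Injective c := by
    rintro ⟨i, m⟩ ⟨i', m'⟩ hp
    have he : -((k : ℤ) * i.val + n * m) = -((k : ℤ) * i'.val + n * m') := hpow hp
    have hn : (n : ℤ) ≠ 0 := by exact_mod_cast NeZero.ne n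
    have hdvd : (n : ℤ) ∣ (i.val : ℤ) - i'.val :=
      (Nat.isCoprime_iff_coprime.2 hnk).dvd_of_dvd_mul_left ⟨m' - m, by linarith⟩
    have hi : (i.val : ℤ) - i'.val = 0 := Int.eq_zero_of_abs_lt_dvd hdvd (by
      have := i.isLt
      have := i'.isLt
      rw [abs_lt]
      omega)
    have hi' : i = i' := Fin.ext (by omega)
    subst hi'
    have : (n : ℤ) * m = n * m' := by linarith
    rw [mul_left_cancel₀ hn this]
  exact single_mem_of_coeff_ne_zero (lattice h) c hc _
    (fun w i m => coeff_torusElement_mulVec s w i m)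
    (fun w hw => mulVec_rot_mem_lattice (hfix s) hw) N hlow hup hw hne

/-! ### The fixed points -/

theorem image_fixedPoints_eq [NeZero n] (hnk : Nat.Coprime n k) :
    Subtype.val '' MulAction.fixedPoints (L (v n k)) (M (v n k)) = tPoint '' labels n k := by
  ext p
  constructor
  · rintro ⟨⟨p, hp⟩, hfix, rfl⟩
    obtain ⟨h, rfl, -⟩ := id hp
    obtain ⟨A, hA⟩ := exists_tPoint_eq_of_smul_eq hnk h fun s =>
      congrArg Subtype.val (hfix ⟨_, torusElement_mem_L n k s⟩)
    exact ⟨A, tPoint_mem_M_iff.1 (hA ▸ hp), hA⟩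
  · rintro ⟨A, hA, rfl⟩
    exact ⟨⟨tPoint A, tPoint_mem_M_iff.2 hA⟩, fun x => Subtype.ext (smul_tPoint x.2 A), rfl⟩

end AffSpringer

end

theorem proposition3 (n k : ℕ) [NeZero n] (hnk : Nat.Coprime n k) :
    DiscreteTopology
      (MulAction.fixedPoints (AffSpringer.L (AffSpringer.v n k))
        (AffSpringer.M (AffSpringer.v n k))) ∧
    Set.BijOn AffSpringer.tPoint (AffSpringer.labels n k)
      (Subtype.val '' MulAction.fixedPoints (AffSpringer.L (AffSpringer.v n k))
        (AffSpringer.M (AffSpringer.v n k))) := by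
  have himage := AffSpringer.image_fixedPoints_eq hnk
  refine ⟨discreteTopology_iff_forall_isClosed.2 fun S => ?_, ?_⟩
  · -- A set of fixed points is the trace of a set of points `[t^{-A}]`, which is closed.
    have hcont : Continuous fun p : MulAction.fixedPoints (AffSpringer.L (AffSpringer.v n k))
        (AffSpringer.M (AffSpringer.v n k)) => (p : AffSpringer.Gr n) :=
      continuous_subtype_val.comp continuous_subtype_val
    convert (AffSpringer.isClosed_tPoint_image
      {A | ∃ p ∈ S, AffSpringer.tPoint A = (p : AffSpringer.Gr n)}).preimage hcont using 1
    ext p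
    constructor
    · intro hp
      obtain ⟨A, -, hA⟩ := himage.subset ⟨p.1, p.2, rfl⟩
      exact ⟨A, ⟨p, hp, hA⟩, hA⟩
    · rintro ⟨A, ⟨q, hq, hqA⟩, hA⟩
      have : q = p := Subtype.ext (Subtype.ext (hqA.symm.trans hA))
      rwa [← this]
  · rw [himage]
    exact AffSpringer.tPoint_injective.injOn.bijOn_image
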